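/- **Proposition 4.3.** Let $\Delta=\sum_{m\ge 0} q^{(2m+1)^2}\in\mathbf F_2[[q]]$ and let $\mathcal F\subset \mathbf F_2[\Delta]\subset\mathbf F_2[[q]]$ be the $\mathbf F_2$-vector space spanned by $\Delta,\Delta^3,\Delta^5,\dots$. For $f=\sum_{n\ge0}c(n)q^n\in\mathbf F_2[[q]]$ let $T_3f=\sum_{n\ge0}\gamma(n)q^n$, where $\gamma(n)=c(3n)$ if $3\nmid n$ and $\gamma(n)=c(3n)+c(n/3)$ if $3\mid n$. For an integer $k=\sum_{i\ge0}\beta_i2^i\ge 0$ with $\beta_i\in\{0,1\}$ put $$n_3(k)=\sum_{i\ge0}\beta_{2i+1}2^i,\qquad n_5(k)=\sum_{i\ge0}\beta_{2i+2}2^i,\qquad h(k)=n_3(k)+n_5(k),$$ and call $[n_3(k),n_5(k)]$ the code of $k$. For $k,\ell$ of the same parity write $k\prec\ell$ if $h(k)<h(\ell)$, or $h(k)=h(\ell)$ and $n_5(k)<n_5(\ell)$; this is a strict total order on the odd natural numbers. Every nonzero $f\in\mathcal F$ can be written uniquely as $f=\Delta^{m_1}+\dots+\Delta^{m_r}$ with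 $r\ge1$, all $m_i$ odd and $m_1\succ m_2\succ\dots\succ m_r$; $m_1$ is called the dominant exponent of $f$, and one sets $h(f)=h(m_1)$. Also $h(0)=-\infty$. Let $f\in\mathcal F$, $f\ne0$, with dominant exponent $m_1$. Then $T_3f\in\mathcal F$, and: (i) $h(T_3f)\le h(f)-1=h(m_1)-1$. (ii) If $n_3(m_1)\ge1$, then $h(T_3f)=h(m_1)-1$, and the dominant exponent of $T_3f$ has code $[n_3(m_1)-1,\,n_5(m_1)]$. -/

import Mathlib

namespace ModTwoForms

open PowerSeries

/-- The reduction modulo 2 of the discriminant form: `Δ = ∑_{m ≥ 0} q^((2m+1)^2)` in `𝔽₂⟦q⟧`. -/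
noncomputable def Delta : PowerSeries (ZMod 2) :=
  open Classical in PowerSeries.mk fun n => if ∃ m : ℕ, n = (2 * m + 1) ^ 2 then 1 else 0

/-- The `𝔽₂`-vector space `𝓕` spanned by `Δ, Δ³, Δ⁵, …`. -/
noncomputable def oddForms : Submodule (ZMod 2) (PowerSeries (ZMod 2)) :=
  Submodule.span (ZMod 2) {g | ∃ k : ℕ, Odd k ∧ g = Delta ^ k}

/-- The Hecke operator `T_p` modulo 2 (used for odd primes `p`) on `q`-expansions: the `n`-th
coefficient of `T_p f` is `c(pn)` if `p ∤ n` and `c(pn) + c(n/p)` if `p ∣ n`. -/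
noncomputable def hecke (p : ℕ) (f : PowerSeries (ZMod 2)) : PowerSeries (ZMod 2) :=
  PowerSeries.mk fun n =>
    if p ∣ n then coeff (p * n) f + coeff (n / p) f else coeff (p * n) f

/-- `n₃(k) = ∑ᵢ β_{2i+1} 2^i`, where `k = ∑ᵢ βᵢ 2^i` in base 2.
The terms with `i ≥ k` vanish, so the sum is cut off there. -/
def n3 (k : ℕ) : ℕ := ∑ i ∈ Finset.range k, (k.testBit (2 * i + 1)).toNat * 2 ^ i

/-- `n₅(k) = ∑ᵢ β_{2i+2} 2^i`, where `k = ∑ᵢ βᵢ 2^i` in base 2.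
The terms with `i ≥ k` vanish, so the sum is cut off there. -/
def n5 (k : ℕ) : ℕ := ∑ i ∈ Finset.range k, (k.testBit (2 * i + 2)).toNat * 2 ^ i

/-- `h(k) = n₃(k) + n₅(k)` for a natural number `k`. -/
def height (k : ℕ) : ℕ := n3 k + n5 k

/-- The code `[n₃(k), n₅(k)]` of `k`. -/
def code (k : ℕ) : ℕ × ℕ := (n3 k, n5 k)

/-- `k ≺ l`: `l` dominates `k`. -/
def Dominated (k l : ℕ) : Prop :=
  k % 2 = l % 2 ∧ (height k < height l ∨ (height k = height l ∧ n5 k < n5 l))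

/-- `m` is the dominant exponent of `f`: `f` is a sum of distinct odd powers of `Δ`, one of
which is `Δ ^ m`, and `m` dominates all the other exponents. -/
def IsDominantExponent (f : PowerSeries (ZMod 2)) (m : ℕ) : Prop :=
  ∃ s : Finset ℕ, (∀ k ∈ s, Odd k) ∧ f = ∑ k ∈ s, Delta ^ k ∧ m ∈ s ∧
    ∀ k ∈ s, k ≠ m → Dominated k m

/-- `h(f) = h(m)` if `m` is the dominant exponent of `f ∈ 𝓕`, `f ≠ 0`; and `h(0) = -∞`.
(The value is `-∞` by convention if `f ∉ 𝓕`.) -/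
noncomputable def formHeight (f : PowerSeries (ZMod 2)) : WithBot ℤ :=
  open Classical in
  if hf : ∃ m, IsDominantExponent f m then (((height hf.choose : ℕ) : ℤ) : WithBot ℤ) else ⊥

/-! Well-definedness: a nonzero element of `𝓕` has exactly one dominant exponent,
and `0` has none. -/

theorem coeff_Delta_pow_of_lt {k j : ℕ} (hkj : k < j) : coeff k (Delta ^ j) = 0 := by
  have h1 : (X : PowerSeries (ZMod 2)) ∣ Delta := by
    rw [PowerSeries.X_dvd_iff, ← PowerSeries.coeff_zero_eq_constantCoeff_apply]
    simp only [Delta, coeff_mk]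
    exact if_neg fun ⟨m, hm⟩ => absurd hm.symm (by positivity)
  exact (PowerSeries.X_pow_dvd_iff.1 (pow_dvd_pow_of_dvd h1 j)) k hkj

theorem coeff_Delta_pow_self (k : ℕ) : coeff k (Delta ^ k) = 1 := by
  have h1 : (X : PowerSeries (ZMod 2)) ∣ Delta := by
    rw [PowerSeries.X_dvd_iff, ← PowerSeries.coeff_zero_eq_constantCoeff_apply]
    simp only [Delta, coeff_mk]
    exact if_neg fun ⟨m, hm⟩ => absurd hm.symm (by positivity)
  obtain ⟨u, hu⟩ := h1
  have h2 : coeff 1 Delta = 1 := by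
    simp only [Delta, coeff_mk]
    exact if_pos ⟨0, rfl⟩
  have h3 : constantCoeff u = 1 := by
    rw [hu, show (1 : ℕ) = 0 + 1 from rfl, PowerSeries.coeff_succ_X_mul] at h2
    simpa using h2
  rw [hu, mul_pow, PowerSeries.coeff_X_pow_mul']
  simp [h3]

theorem exponents_unique {s t : Finset ℕ}
    (hst : ∑ k ∈ s, Delta ^ k = ∑ k ∈ t, Delta ^ k) : s = t := by
  have key : ∀ (u : Finset ℕ) (k : ℕ), coeff k (∑ j ∈ u, Delta ^ j) =
      (∑ j ∈ u.filter (· < k), coeff k (Delta ^ j)) + if k ∈ u then 1 else 0 := by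
    intro u k
    rw [map_sum, ← Finset.sum_filter_add_sum_filter_not u (· < k)]
    congr 1
    rw [← Finset.sum_filter_add_sum_filter_not _ (· = k), Finset.filter_filter,
      Finset.filter_filter]
    rw [Finset.sum_eq_zero (s := u.filter fun a => ¬ a < k ∧ ¬ a = k), add_zero]
    · split_ifs with hk
      · rw [Finset.sum_eq_single k]
        · exact coeff_Delta_pow_self k
        · intro b hb hbk
          exact absurd (Finset.mem_filter.1 hb).2.2 hbk
        · intro hn
          exact absurd (Finset.mem_filter.2 ⟨hk, by simp⟩) hn
      · apply Finset.sum_eq_zero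
        intro b hb
        obtain ⟨hb1, hb2⟩ := Finset.mem_filter.1 hb
        exact absurd (hb2.2 ▸ hb1) hk
    · intro b hb
      obtain ⟨-, hb2⟩ := Finset.mem_filter.1 hb
      exact coeff_Delta_pow_of_lt (by omega)
  ext k
  induction k using Nat.strong_induction_on with
  | _ k ih =>
    have h1 := congrArg (coeff k) hst
    have h2 : s.filter (· < k) = t.filter (· < k) := by
      ext j
      simp only [Finset.mem_filter]
      exact ⟨fun h => ⟨(ih j h.2).1 h.1, h.2⟩, fun h => ⟨(ih j h.2).2 h.1, h.2⟩⟩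
    rw [key, key, h2] at h1
    have h3 := add_left_cancel h1
    by_cases hs : k ∈ s <;> by_cases ht : k ∈ t <;> simp [hs, ht] at h3 ⊢

theorem Dominated.asymm {k l : ℕ} (h1 : Dominated k l) (h2 : Dominated l k) : False := by
  unfold Dominated at h1 h2
  omega

theorem IsDominantExponent.unique {f : PowerSeries (ZMod 2)} {m m' : ℕ}
    (h : IsDominantExponent f m) (h' : IsDominantExponent f m') : m = m' := by
  obtain ⟨s, -, hs, hm, hd⟩ := h
  obtain ⟨t, -, ht, hm', hd'⟩ := h'
  obtain rfl : s = t := exponents_unique (hs.symm.trans ht)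
  by_contra hne
  exact (hd' m hm hne).asymm (hd m' hm' fun e => hne e.symm)

theorem IsDominantExponent.ne_zero {f : PowerSeries (ZMod 2)} {m : ℕ}
    (h : IsDominantExponent f m) : f ≠ 0 := by
  rintro rfl
  obtain ⟨s, -, hs, hm, -⟩ := h
  have : s = ∅ := exponents_unique (by rw [← hs, Finset.sum_empty])
  simp [this] at hm

theorem IsDominantExponent.formHeight_eq {f : PowerSeries (ZMod 2)} {m : ℕ}
    (h : IsDominantExponent f m) : formHeight f = ((height m : ℤ) : WithBot ℤ) := by
  have hf : ∃ m, IsDominantExponent f m := ⟨m, h⟩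
  rw [formHeight, dif_pos hf, hf.choose_spec.unique h]

theorem formHeight_zero : formHeight 0 = ⊥ := by
  rw [formHeight, dif_neg]
  rintro ⟨m, hm⟩
  exact hm.ne_zero rfl

theorem testBit_sum_step (c k : ℕ) :
    ∑ i ∈ Finset.range k, (k.testBit (2 * i + c)).toNat * 2 ^ i =
      (k / 2 ^ c) % 2 +
        2 * ∑ i ∈ Finset.range (k / 4), ((k / 4).testBit (2 * i + c)).toNat * 2 ^ i := by
  have ext : ∀ (a N : ℕ), a ≤ N →
      ∑ i ∈ Finset.range a, (a.testBit (2 * i + c)).toNat * 2 ^ i =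
        ∑ i ∈ Finset.range N, (a.testBit (2 * i + c)).toNat * 2 ^ i := by
    intro a N haN
    apply Finset.sum_subset (Finset.range_subset_range.2 haN)
    intro i _ hi
    have hi : a ≤ i := by simpa using hi
    have : a < 2 ^ (2 * i + c) :=
      lt_of_lt_of_le Nat.lt_two_pow_self (Nat.pow_le_pow_right (by norm_num) (by omega))
    simp [Nat.testBit_lt_two_pow this]
  rw [ext k (k + 1) (by omega), ext (k / 4) k (by omega), Finset.sum_range_succ',
    Finset.mul_sum, add_comm]
  congr 1
  · simp [Nat.testBit_eq_decide_div_mod_eq]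
    rcases Nat.mod_two_eq_zero_or_one (k / 2 ^ c) with h | h <;> simp [h]
  · apply Finset.sum_congr rfl
    intro i _
    have : k.testBit (2 * (i + 1) + c) = (k / 4).testBit (2 * i + c) := by
      rw [show (4 : ℕ) = 2 ^ 2 from rfl, Nat.testBit_div_two_pow]
      congr 1
      omega
    rw [this]
    ring

theorem n3_step (k : ℕ) : n3 k = (k / 2) % 2 + 2 * n3 (k / 4) := by
  simpa [n3] using testBit_sum_step 1 k

theorem n5_step (k : ℕ) : n5 k = (k / 4) % 2 + 2 * n5 (k / 4) := by
  simpa [n5] using testBit_sum_step 2 k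

theorem code_injective_of_parity {k l : ℕ} (hp : k % 2 = l % 2) (h3 : n3 k = n3 l)
    (h5 : n5 k = n5 l) : k = l := by
  induction k using Nat.strong_induction_on generalizing l with
  | _ k ih =>
    rw [n3_step k, n3_step l] at h3
    rw [n5_step k, n5_step l] at h5
    by_cases hk : k = 0
    · subst hk
      by_contra hl
      have h0 : n3 0 = 0 := rfl
      have h0' : n5 0 = 0 := rfl
      have : ∀ l : ℕ, l % 2 = 0 → n3 l = 0 → n5 l = 0 → l = 0 := by
        intro l
        induction l using Nat.strong_induction_on with
        | _ l ih2 =>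
          intro a b c
          rw [n3_step] at b
          rw [n5_step] at c
          by_contra hl
          have := ih2 (l / 4) (by omega) (by omega) (by omega) (by omega)
          omega
      simp only [Nat.zero_div, h0] at h3
      simp only [Nat.zero_div, h0'] at h5
      refine hl (this l (by omega) ?_ ?_).symm
      · rw [n3_step]
        omega
      · rw [n5_step]
        omega
    · have := ih (k / 4) (by omega) (l := l / 4) (by omega) (by omega) (by omega)
      omega

theorem exists_exponents {f : PowerSeries (ZMod 2)} (hf : f ∈ oddForms) :
    ∃ s : Finset ℕ, (∀ k ∈ s, Odd k) ∧ f = ∑ k ∈ s, Delta ^ k := by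
  unfold oddForms at hf
  induction hf using Submodule.span_induction with
  | mem x hx =>
    obtain ⟨k, hk, rfl⟩ := hx
    exact ⟨{k}, by simpa using hk, by simp⟩
  | zero => exact ⟨∅, by simp, by simp⟩
  | add x y _ _ hx hy =>
    obtain ⟨s, hs, rfl⟩ := hx
    obtain ⟨t, ht, rfl⟩ := hy
    refine ⟨(s \ t) ∪ (t \ s), ?_, ?_⟩
    · intro k hk
      simp only [Finset.mem_union, Finset.mem_sdiff] at hk
      rcases hk with hk | hk
      exacts [hs k hk.1, ht k hk.1]
    · rw [Finset.sum_union (by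
        rw [Finset.disjoint_left]
        intro a ha hb
        exact (Finset.mem_sdiff.1 hb).2 (Finset.mem_sdiff.1 ha).1)]
      rw [← Finset.sum_inter_add_sum_sdiff s t, ← Finset.sum_inter_add_sum_sdiff t s,
        Finset.inter_comm t s]
      have h2 : ∀ z : PowerSeries (ZMod 2), z + z = 0 := fun z => by
        ext n
        simpa using CharTwo.add_self_eq_zero (coeff n z)
      have h3 := h2 (∑ x ∈ s ∩ t, Delta ^ x)
      linear_combination h3
  | smul a x _ hx =>
    obtain ⟨s, hs, rfl⟩ := hx
    have ha : a = 0 ∨ a = 1 := by revert a; decide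
    rcases ha with rfl | rfl
    · exact ⟨∅, by simp, by simp⟩
    · exact ⟨s, hs, by simp⟩

theorem exists_isDominantExponent {f : PowerSeries (ZMod 2)} (hf : f ∈ oddForms) (h0 : f ≠ 0) :
    ∃ m, IsDominantExponent f m := by
  obtain ⟨s, hs, rfl⟩ := exists_exponents hf
  have hne : s.Nonempty := by
    rw [Finset.nonempty_iff_ne_empty]
    rintro rfl
    simp at h0
  obtain ⟨m, hm, hmax⟩ := s.exists_max_image (fun k => toLex (height k, n5 k)) hne
  refine ⟨m, s, hs, rfl, hm, fun k hk hkm => ?_⟩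
  have h1 := hmax k hk
  have hp : k % 2 = m % 2 := by
    rw [Nat.odd_iff.1 (hs k hk), Nat.odd_iff.1 (hs m hm)]
  rw [Prod.Lex.toLex_le_toLex] at h1
  refine ⟨hp, ?_⟩
  rcases h1 with h1 | ⟨h1, h2⟩
  · exact Or.inl h1
  · refine Or.inr ⟨h1, lt_of_le_of_ne h2 fun h5 => hkm (code_injective_of_parity hp ?_ h5)⟩
    simp only [height] at h1 h5
    omega

end ModTwoForms

namespace ModTwoForms

open PowerSeries

/-! ### Codes of odd numbers, read off four digits at a time -/

/-! Write Y = Δ(q^3). Modulo 2, T₃ is the sum of c(n) ↦ c(3n) (`thin`) and the substitution q ↦ q^3,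
and the symmetric modular equation ΔY = Δ^4 + Y^4 (`Delta_mul_expand_Delta`) yields T₃(Δ^(k+4)) = Δ
T₃(Δ^(k+1)) + Δ^4 T₃(Δ^k). As T₃ kills 1, Δ, Δ^2 and sends Δ^3 to Δ, T₃(Δ^k) = P_k(Δ) with ∑ P_k t^k
= X t^3 / (1 - X t^3 - X^4 t^4). So P_k has only monomials X^(1+a+4b) with k = 3+3a+4b, and their
coefficients are the binomials (a+b choose a) modulo 2 (`coeff_heckePoly`).

The rest concerns binary digits. By Lucas, a monomial survives when the digits of a and b are
disjoint. For odd k, following carries in base four (`heightDrop_le`) shows that each surviving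
exponent j has h(j) ≤ h(k) - 1 and h(j) + n₅(j) ≤ h(k) + n₅(k) - 1, so its code does not exceed
[n₃(k) - 1, n₅(k)]. If n₃(k) ≥ 1, that code is attained (`exists_code_pred`). Exponents k dominated
by m₁ obey strictly smaller bounds, so the leading term of T₃(Δ^m₁) cannot cancel in T₃ f. -/

theorem n3_two_mul_add_one (x : ℕ) : n3 (2 * x + 1) = x % 2 + 2 * n3 (2 * (x / 4) + 1) := by
  rw [n3_step (2 * x + 1), n3_step ((2 * x + 1) / 4), n3_step (2 * (x / 4) + 1),
    show (2 * x + 1) / 2 = x by omega, show (2 * x + 1) / 4 / 2 = x / 4 by omega,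
    show (2 * (x / 4) + 1) / 2 = x / 4 by omega,
    show (2 * x + 1) / 4 / 4 = (2 * (x / 4) + 1) / 4 by omega]

/-- With the companion for `n3`: the i-th base-four digit of x holds the i-th binary digits of both
entries of the code of 2x+1, `n3` in its low bit and `n5` in its high bit. -/
theorem n5_two_mul_add_one (x : ℕ) :
    n5 (2 * x + 1) = x / 2 % 2 + 2 * n5 (2 * (x / 4) + 1) := by
  rw [n5_step (2 * x + 1), n5_step ((2 * x + 1) / 4), n5_step (2 * (x / 4) + 1),
    show (2 * x + 1) / 4 = x / 2 by omega, show x / 2 / 4 = (2 * (x / 4) + 1) / 4 by omega]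

/-! ### Parity of binomial coefficients -/

/-- One digit of Lucas' theorem: the binomial is odd exactly when the two parts share no binary
digit. -/
theorem odd_choose_two_mul_add_iff {x y p q : ℕ} (hp : p < 2) (hq : q < 2) :
    Odd ((2 * x + p + (2 * y + q)).choose (2 * x + p)) ↔
      p * q = 0 ∧ Odd ((x + y).choose x) := by
  have key := Choose.choose_modEq_choose_mod_mul_choose_div_nat (p := 2)
    (n := 2 * x + p + (2 * y + q)) (k := 2 * x + p)
  rw [Nat.odd_iff, key, ← Nat.odd_iff, Nat.odd_mul]
  interval_cases p <;> interval_cases q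
  · rw [show (2 * x + 0 + (2 * y + 0)) / 2 = x + y by omega, show (2 * x + 0) / 2 = x by omega,
      show (2 * x + 0 + (2 * y + 0)) % 2 = 0 by omega, show (2 * x + 0) % 2 = 0 by omega]
    simp
  · rw [show (2 * x + 0 + (2 * y + 1)) / 2 = x + y by omega, show (2 * x + 0) / 2 = x by omega,
      show (2 * x + 0 + (2 * y + 1)) % 2 = 1 by omega, show (2 * x + 0) % 2 = 0 by omega]
    simp
  · rw [show (2 * x + 1 + (2 * y + 0)) / 2 = x + y by omega, show (2 * x + 1) / 2 = x by omega,
      show (2 * x + 1 + (2 * y + 0)) % 2 = 1 by omega, show (2 * x + 1) % 2 = 1 by omega]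
    simp
  · rw [show (2 * x + 1 + (2 * y + 1)) % 2 = 0 by omega, show (2 * x + 1) % 2 = 1 by omega]
    simp

theorem odd_choose_four_mul_add_iff {x y p q : ℕ} (hp : p < 4) (hq : q < 4) :
    Odd ((4 * x + p + (4 * y + q)).choose (4 * x + p)) ↔
      ((p % 2) * (q % 2) = 0 ∧ (p / 2) * (q / 2) = 0) ∧ Odd ((x + y).choose x) := by
  have h1 := odd_choose_two_mul_add_iff (x := 2 * x + p / 2) (y := 2 * y + q / 2)
    (p := p % 2) (q := q % 2) (by omega) (by omega)
  have h2 := odd_choose_two_mul_add_iff (x := x) (y := y)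
    (p := p / 2) (q := q / 2) (by omega) (by omega)
  rw [show 2 * (2 * x + p / 2) + p % 2 = 4 * x + p by omega,
    show 2 * (2 * y + q / 2) + q % 2 = 4 * y + q by omega] at h1
  rw [h1, h2, and_assoc]

/-! ### The drop of the height -/

/-- The triples `(u, v, p)` consisting of the carries `u`, `v` of the base-four additions `a + b`
and `1 + 3 * a + b`, and the preceding digit `p` of `a`, that occur when the binary digits of
`4 * a + 1` and `b` are disjoint. -/
def carryStates : Finset (ℕ × ℕ × ℕ) :=
  {(0, 0, 0), (0, 0, 1), (0, 1, 1), (0, 1, 2), (0, 2, 2), (0, 2, 3), (1, 1, 1), (1, 2, 2),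
    (1, 2, 3), (1, 3, 3)}

/-- A lower bound for the difference of the heights at a carry state. -/
def heightDrop (u v p : ℕ) : ℕ := if v = 1 ∧ p = 2 then 0 else (v + 1) / 2 - u

/-- One step of a finite automaton reading digits α of a and β of b. A digit r of the result adds r
% 2 + r / 2 to the height and r to height plus `n5`. The potentials `heightDrop` and v - u are
doubled after the step because codes weigh the next digit twice as much. -/
theorem carryStates_step : ∀ s ∈ carryStates, ∀ α ∈ Finset.range 4, ∀ β ∈ Finset.range 4,
    (s.2.2 % 2) * (β % 2) = 0 ∧ (s.2.2 / 2) * (β / 2) = 0 →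
    ((α + β + s.1) / 4, (3 * α + β + s.2.1) / 4, α) ∈ carryStates ∧
    (α + β + s.1) % 4 % 2 + (α + β + s.1) % 4 / 2 + heightDrop s.1 s.2.1 s.2.2 ≤
      (3 * α + β + s.2.1) % 4 % 2 + (3 * α + β + s.2.1) % 4 / 2 +
        2 * heightDrop ((α + β + s.1) / 4) ((3 * α + β + s.2.1) / 4) α ∧
    (α + β + s.1) % 4 + (s.2.1 - s.1) ≤
      (3 * α + β + s.2.1) % 4 + 2 * ((3 * α + β + s.2.1) / 4 - (α + β + s.1) / 4) := by
  decide +kernel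

/-- The end of the reading: once a and b are exhausted, the carries are themselves the last digits.
-/
theorem carryStates_bound : ∀ s ∈ carryStates, s.1 < 4 ∧ s.2.1 < 4 ∧ s.2.2 < 4 ∧
    s.1 % 2 + s.1 / 2 + heightDrop s.1 s.2.1 s.2.2 ≤ s.2.1 % 2 + s.2.1 / 2 ∧
    s.1 + (s.2.1 - s.1) ≤ s.2.1 := by
  decide +kernel

/-- The inequalities of `carryStates_step` telescope over the digits. The state remembers p because
disjointness compares each digit of b with the preceding digit of a. -/
theorem heightDrop_le (N : ℕ) : ∀ a b u v p : ℕ, a + b ≤ N → (u, v, p) ∈ carryStates →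
    Odd ((4 * a + p + b).choose (4 * a + p)) →
    height (2 * (a + b + u) + 1) + heightDrop u v p ≤ height (2 * (3 * a + b + v) + 1) ∧
    height (2 * (a + b + u) + 1) + n5 (2 * (a + b + u) + 1) + (v - u) ≤
      height (2 * (3 * a + b + v) + 1) + n5 (2 * (3 * a + b + v) + 1) := by
  induction N using Nat.strong_induction_on with
  | _ N ih =>
    intro a b u v p hN hs hodd
    obtain ⟨hu, hv, hp, hb1, hb2⟩ := carryStates_bound _ hs
    simp only at hu hv hp hb1 hb2
    have e3 := n3_two_mul_add_one (a + b + u)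
    have e5 := n5_two_mul_add_one (a + b + u)
    have f3 := n3_two_mul_add_one (3 * a + b + v)
    have f5 := n5_two_mul_add_one (3 * a + b + v)
    simp only [height]
    rcases Nat.eq_zero_or_pos (a + b) with h0 | h0
    · obtain ⟨rfl, rfl⟩ : a = 0 ∧ b = 0 := by omega
      simp only [Nat.mul_zero, Nat.zero_add, Nat.div_eq_of_lt hu, Nat.div_eq_of_lt hv] at *
      have z3 : n3 1 = 0 := rfl
      have z5 : n5 1 = 0 := rfl
      omega
    · obtain ⟨x, α, hα, rfl⟩ : ∃ x α, α < 4 ∧ a = 4 * x + α :=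
        ⟨a / 4, a % 4, by omega, by omega⟩
      obtain ⟨y, β, hβ, rfl⟩ : ∃ y β, β < 4 ∧ b = 4 * y + β :=
        ⟨b / 4, b % 4, by omega, by omega⟩
      obtain ⟨hd, hodd'⟩ := (odd_choose_four_mul_add_iff hp hβ).1 hodd
      obtain ⟨hs', hh, hw⟩ := carryStates_step _ hs α (Finset.mem_range.2 hα) β
        (Finset.mem_range.2 hβ) hd
      simp only at hs' hh hw
      obtain ⟨i1, i2⟩ := ih (x + y) (by omega) x y _ _ _ le_rfl hs' hodd'
      rw [show (4 * x + α + (4 * y + β) + u) / 4 = x + y + (α + β + u) / 4 by omega] at e3 e5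
      rw [show (3 * (4 * x + α) + (4 * y + β) + v) / 4 = 3 * x + y + (3 * α + β + v) / 4
        by omega] at f3 f5
      rw [show (4 * x + α + (4 * y + β) + u) % 2 = (α + β + u) % 4 % 2 by omega] at e3
      rw [show (4 * x + α + (4 * y + β) + u) / 2 % 2 = (α + β + u) % 4 / 2 by omega] at e5
      rw [show (3 * (4 * x + α) + (4 * y + β) + v) % 2 = (3 * α + β + v) % 4 % 2 by omega] at f3
      rw [show (3 * (4 * x + α) + (4 * y + β) + v) / 2 % 2 = (3 * α + β + v) % 4 / 2
        by omega] at f5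
      have d1 := Nat.div_add_mod ((α + β + u) % 4) 2
      have d2 := Nat.div_add_mod ((3 * α + β + v) % 4) 2
      simp only [height] at i1 i2
      rw [e3, e5, f3, f5]
      generalize (3 * α + β + v) / 4 - (α + β + u) / 4 = t at *
      generalize heightDrop ((α + β + u) / 4) ((3 * α + β + v) / 4) α = t' at *
      generalize (α + β + u) % 4 / 2 = r₁, (α + β + u) % 4 % 2 = r₂,
        (α + β + u) % 4 = r, (3 * α + β + v) % 4 / 2 = r₁', (3 * α + β + v) % 4 % 2 = r₂',
        (3 * α + β + v) % 4 = r' at *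
      clear e3 e5 f3 f5 hd hN h0 ih hb1 hb2
      constructor <;> linarith

/-- If the binary digits of `2 * a` and `b` are disjoint, then `1 + 2 * a + 4 * b` is at most the
number whose code is that of `3 + 6 * a + 4 * b` with the first entry lowered by one. -/
theorem height_add_one_le {a b : ℕ} (h : Odd ((2 * a + b).choose (2 * a))) :
    height (1 + 2 * a + 4 * b) + 1 ≤ height (3 + 6 * a + 4 * b) ∧
    height (1 + 2 * a + 4 * b) + n5 (1 + 2 * a + 4 * b) + 1 ≤
      height (3 + 6 * a + 4 * b) + n5 (3 + 6 * a + 4 * b) := by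
  -- The fictitious preceding digit 1 is harmless, since 2b is even. In the initial state (0, 1, 1)
  -- both potentials equal 1.
  have h1 := (odd_choose_two_mul_add_iff (x := 2 * a) (y := b) (p := 1) (q := 0)
    (by norm_num) (by norm_num)).2 ⟨rfl, h⟩
  rw [show 2 * (2 * a) + 1 = 4 * a + 1 by omega, Nat.add_zero] at h1
  have h2 := heightDrop_le _ a (2 * b) 0 1 1 le_rfl (by decide) h1
  rwa [show 2 * (a + 2 * b + 0) + 1 = 1 + 2 * a + 4 * b by omega,
    show 2 * (3 * a + 2 * b + 1) + 1 = 3 + 6 * a + 4 * b by omega] at h2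

/-- The number whose code is that of `2 * x + 1` with the first entry lowered by one. -/
theorem exists_code_pred (x : ℕ) (hx : 1 ≤ n3 (2 * x + 1)) :
    ∃ a b : ℕ, x = 1 + 3 * a + 2 * b ∧ Odd ((2 * a + b).choose (2 * a)) ∧
      n3 (1 + 2 * a + 4 * b) + 1 = n3 (2 * x + 1) ∧ n5 (1 + 2 * a + 4 * b) = n5 (2 * x + 1) := by
  induction x using Nat.strong_induction_on with
  | _ x ih =>
    have e3 := n3_two_mul_add_one x
    have e5 := n5_two_mul_add_one x
    rcases Nat.mod_two_eq_zero_or_one x with h0 | h0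
    · have hx0 : x ≠ 0 := by
        rintro rfl
        exact absurd hx (by decide)
      -- The last binary digit of `n3` is 0, so subtracting one borrows: this digit becomes 1 and
      -- one is subtracted from the rest, carried by x / 4.
      obtain ⟨a, b, hab, hodd, h3, h5⟩ := ih (x / 4) (by omega) (by omega)
      have hr : x % 4 / 2 < 2 := by omega
      refine ⟨4 * a + 1, 4 * b + x % 4 / 2, by omega, ?_, ?_, ?_⟩
      · have h1 := (odd_choose_four_mul_add_iff (x := 2 * a) (y := b) (p := 2) (q := x % 4 / 2)
          (by omega) (by omega)).2 ⟨⟨by simp, by simp; omega⟩, hodd⟩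
        rwa [show 4 * (2 * a) + 2 = 2 * (4 * a + 1) by ring] at h1
      · have f3 := n3_two_mul_add_one (4 * a + 1 + 2 * (4 * b + x % 4 / 2))
        rw [show 2 * ((4 * a + 1 + 2 * (4 * b + x % 4 / 2)) / 4) + 1 = 1 + 2 * a + 4 * b
          by omega] at f3
        rw [show 1 + 2 * (4 * a + 1) + 4 * (4 * b + x % 4 / 2) =
          2 * (4 * a + 1 + 2 * (4 * b + x % 4 / 2)) + 1 by ring]
        omega
      · have f5 := n5_two_mul_add_one (4 * a + 1 + 2 * (4 * b + x % 4 / 2))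
        rw [show 2 * ((4 * a + 1 + 2 * (4 * b + x % 4 / 2)) / 4) + 1 = 1 + 2 * a + 4 * b
          by omega] at f5
        rw [show 1 + 2 * (4 * a + 1) + 4 * (4 * b + x % 4 / 2) =
          2 * (4 * a + 1 + 2 * (4 * b + x % 4 / 2)) + 1 by ring]
        omega
    -- No borrow: the new exponent is 2x - 1, with only the last digit of `n3` cleared.
    · refine ⟨0, x / 2, by omega, by simp, ?_, ?_⟩
      · have f3 := n3_two_mul_add_one (2 * (x / 2))
        rw [show 2 * (x / 2) / 4 = x / 4 by omega] at f3
        rw [show 1 + 2 * 0 + 4 * (x / 2) = 2 * (2 * (x / 2)) + 1 by ring]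
        omega
      · have f5 := n5_two_mul_add_one (2 * (x / 2))
        rw [show 2 * (x / 2) / 4 = x / 4 by omega] at f5
        rw [show 1 + 2 * 0 + 4 * (x / 2) = 2 * (2 * (x / 2)) + 1 by ring]
        omega

/-! ### Operators on power series -/

instance : CharP (PowerSeries (ZMod 2)) 2 :=
  charP_of_injective_algebraMap (algebraMap (ZMod 2) (PowerSeries (ZMod 2))).injective 2

theorem sq_eq_expand (f : PowerSeries (ZMod 2)) : f ^ 2 = expand 2 two_ne_zero f := by
  have h : (f.expand 2 two_ne_zero).map (frobenius (ZMod 2) 2) = f ^ 2 :=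
    MvPowerSeries.map_frobenius_expand 2 two_ne_zero
  rw [← h, ZMod.frobenius_zmod]
  ext n
  simp

theorem pow_four_eq_expand (f : PowerSeries (ZMod 2)) : f ^ 4 = expand 4 four_ne_zero f := by
  rw [show f ^ 4 = (f ^ 2) ^ 2 by ring, sq_eq_expand (f ^ 2), sq_eq_expand f]
  exact (expand_mul 2 two_ne_zero 2 two_ne_zero f).symm

/-- The operator `∑ c(n) q^n ↦ ∑ c(3n) q^n`. -/
noncomputable def thin : PowerSeries (ZMod 2) →ₗ[ZMod 2] PowerSeries (ZMod 2) where
  toFun f := PowerSeries.mk fun n => coeff (3 * n) f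
  map_add' f g := by ext; simp
  map_smul' c f := by ext; simp

theorem coeff_thin (f : PowerSeries (ZMod 2)) (n : ℕ) : coeff n (thin f) = coeff (3 * n) f :=
  coeff_mk (R := ZMod 2) n fun n => coeff (3 * n) f

theorem hecke_three_eq (f : PowerSeries (ZMod 2)) :
    hecke 3 f = thin f + expand 3 three_ne_zero f := by
  ext n
  rw [map_add, coeff_thin, coeff_expand, hecke, coeff_mk]
  split_ifs <;> simp

/-- Exponents of g(q^3) are multiples of 3, so at q^(3n) only terms of f with exponent divisible by
3 contribute. -/
theorem thin_mul_expand (f g : PowerSeries (ZMod 2)) :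
    thin (f * expand 3 three_ne_zero g) = thin f * g := by
  ext n
  rw [coeff_thin, coeff_mul, coeff_mul]
  symm
  refine Finset.sum_of_injOn (fun x => (3 * x.1, 3 * x.2)) ?_ ?_ ?_ ?_
  · rintro ⟨a, b⟩ - ⟨c, d⟩ - h
    simp only [Prod.mk.injEq] at h ⊢
    omega
  · rintro ⟨a, b⟩ h
    simp only [Finset.mem_coe, Finset.HasAntidiagonal.mem_antidiagonal] at h ⊢
    omega
  · rintro ⟨a, b⟩ h h'
    rw [Finset.HasAntidiagonal.mem_antidiagonal] at h
    simp only at h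
    rw [coeff_expand_of_not_dvd, mul_zero]
    rintro ⟨d, hd⟩
    refine h' ⟨(n - d, d), ?_, ?_⟩
    · simp only [Finset.mem_coe, Finset.HasAntidiagonal.mem_antidiagonal]
      omega
    · simp only [Prod.mk.injEq]
      omega
  · rintro ⟨a, b⟩ -
    rw [coeff_thin, coeff_expand_mul]

theorem thin_expand (f : PowerSeries (ZMod 2)) : thin (expand 3 three_ne_zero f) = f := by
  ext n
  rw [coeff_thin, coeff_expand_mul]

theorem thin_sq (f : PowerSeries (ZMod 2)) : thin (f ^ 2) = thin f ^ 2 := by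
  rw [sq_eq_expand, sq_eq_expand]
  ext n
  rw [coeff_thin, coeff_expand, coeff_expand]
  by_cases h : 2 ∣ n
  · rw [if_pos h, if_pos (by omega), coeff_thin]
    congr 2
    omega
  · rw [if_neg h, if_neg (by omega)]

theorem coeff_expand_Delta (p : ℕ) (hp : p ≠ 0) (n : ℕ) [Decidable (∃ m, n = p * (2 * m + 1) ^ 2)] :
    coeff n (expand p hp Delta) = if ∃ m, n = p * (2 * m + 1) ^ 2 then 1 else 0 := by
  classical
  rw [coeff_expand]
  by_cases h : p ∣ n
  · obtain ⟨k, rfl⟩ := h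
    rw [if_pos (dvd_mul_right _ _), Nat.mul_div_cancel_left _ (Nat.pos_of_ne_zero hp), Delta,
      coeff_mk]
    simp only [mul_right_inj' hp]
  · rw [if_neg h, if_neg]
    rintro ⟨m, rfl⟩
    exact h (dvd_mul_right _ _)

theorem thin_Delta : thin Delta = expand 3 three_ne_zero Delta := by
  classical
  ext n
  rw [coeff_thin, coeff_expand_Delta, Delta, coeff_mk]
  congr 1
  refine propext ⟨?_, ?_⟩
  · rintro ⟨m, hm⟩
    have h3 : 3 ∣ 2 * m + 1 := Nat.prime_three.dvd_of_dvd_pow (hm ▸ dvd_mul_right 3 n)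
    obtain ⟨c, hc⟩ := h3
    obtain ⟨d, rfl⟩ : ∃ d, c = 2 * d + 1 := ⟨c / 2, by omega⟩
    refine ⟨d, ?_⟩
    rw [hc] at hm
    nlinarith
  · rintro ⟨m, rfl⟩
    exact ⟨3 * m + 1, by ring⟩

/-! ### The modular equation of level three -/

/-- The pairs of odd numbers with `a ^ 2 + 3 * b ^ 2 = n`. -/
def oddPairs (n : ℕ) : Finset (ℕ × ℕ) :=
  (Finset.range (n + 1) ×ˢ Finset.range (n + 1)).filter fun x =>
    x.1 % 2 = 1 ∧ x.2 % 2 = 1 ∧ x.1 ^ 2 + 3 * x.2 ^ 2 = n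

theorem mem_oddPairs {n a b : ℕ} :
    (a, b) ∈ oddPairs n ↔ a % 2 = 1 ∧ b % 2 = 1 ∧ a ^ 2 + 3 * b ^ 2 = n := by
  simp only [oddPairs, Finset.mem_filter, Finset.mem_product, Finset.mem_range]
  refine ⟨fun h => h.2, fun h => ⟨⟨?_, ?_⟩, h⟩⟩ <;> nlinarith [h.2.2]

/-- The involution of the pairs of odd numbers with given `a ^ 2 + 3 * b ^ 2`. -/
def pairSwap (x : ℕ × ℕ) : ℕ × ℕ :=
  if (x.1 + x.2) % 4 = 0 then ((x.1 + 3 * x.2) / 2, ((x.1 - x.2) + (x.2 - x.1)) / 2)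
  else (((x.1 - 3 * x.2) + (3 * x.2 - x.1)) / 2, (x.1 + x.2) / 2)

/-- Up to signs, a + b√-3 is multiplied by (1 - √-3)/2 or (1 + √-3)/2, of norm 1; a + b modulo 4
selects the one giving odd coordinates. Sums of two truncated differences are absolute values. -/
theorem pairSwap_mem {n : ℕ} {x : ℕ × ℕ} (hx : x ∈ oddPairs n) : pairSwap x ∈ oddPairs n := by
  obtain ⟨a, b⟩ := x
  obtain ⟨ha, hb, hn⟩ := mem_oddPairs.1 hx
  unfold pairSwap
  simp only
  split_ifs with h
  · refine mem_oddPairs.2 ⟨by omega, by omega, ?_⟩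
    rcases le_total a b with hab | hab
    · obtain ⟨c, rfl⟩ : ∃ c, b = a + 2 * c := ⟨(b - a) / 2, by omega⟩
      rw [show (a + 3 * (a + 2 * c)) / 2 = 2 * a + 3 * c by omega,
        show (a - (a + 2 * c) + (a + 2 * c - a)) / 2 = c by omega, ← hn]
      ring
    · obtain ⟨c, rfl⟩ : ∃ c, a = b + 2 * c := ⟨(a - b) / 2, by omega⟩
      rw [show (b + 2 * c + 3 * b) / 2 = 2 * b + c by omega,
        show (b + 2 * c - b + (b - (b + 2 * c))) / 2 = c by omega, ← hn]
      ring
  · refine mem_oddPairs.2 ⟨by omega, by omega, ?_⟩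
    rcases le_total a (3 * b) with hab | hab
    · obtain ⟨c, hc⟩ : ∃ c, a + 2 * c = 3 * b := ⟨(3 * b - a) / 2, by omega⟩
      obtain ⟨d, hd⟩ : ∃ d, a + b = 2 * d := ⟨(a + b) / 2, by omega⟩
      rw [show (a - 3 * b + (3 * b - a)) / 2 = c by omega, hd,
        show 2 * d / 2 = d by omega, ← hn]
      zify at hc hd ⊢
      rw [show (a : ℤ) = 2 * d - b by linarith, show (c : ℤ) = 2 * b - d by linarith]
      ring
    · obtain ⟨c, rfl⟩ : ∃ c, a = 3 * b + 2 * c := ⟨(a - 3 * b) / 2, by omega⟩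
      rw [show (3 * b + 2 * c - 3 * b + (3 * b - (3 * b + 2 * c))) / 2 = c by omega,
        show (3 * b + 2 * c + b) / 2 = 2 * b + c by omega, ← hn]
      ring

theorem pairSwap_pairSwap {n : ℕ} {x : ℕ × ℕ} (hx : x ∈ oddPairs n) :
    pairSwap (pairSwap x) = x := by
  obtain ⟨a, b⟩ := x
  obtain ⟨ha, hb, -⟩ := mem_oddPairs.1 hx
  unfold pairSwap
  simp only
  split_ifs with h h' h' <;> simp only at h' ⊢ <;> ext <;> simp only <;> omega

theorem pairSwap_eq_self_iff {n : ℕ} {x : ℕ × ℕ} (hx : x ∈ oddPairs n) :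
    pairSwap x = x ↔ x.1 = 1 * x.2 ∨ x.1 = 3 * x.2 := by
  obtain ⟨a, b⟩ := x
  obtain ⟨ha, hb, -⟩ := mem_oddPairs.1 hx
  unfold pairSwap
  split_ifs with h <;> simp only [Prod.mk.injEq] at h ⊢ <;> omega

theorem sum_oddPairs_ite (n t : ℕ) (ht : t % 2 = 1)
    [Decidable (∃ m, n = (t ^ 2 + 3) * (2 * m + 1) ^ 2)] :
    ∑ x ∈ oddPairs n, (if x.1 = t * x.2 then 1 else 0 : ZMod 2) =
      if ∃ m, n = (t ^ 2 + 3) * (2 * m + 1) ^ 2 then 1 else 0 := by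
  split_ifs with h
  · obtain ⟨m, hm⟩ := h
    rw [Finset.sum_eq_single (t * (2 * m + 1), 2 * m + 1)]
    · simp
    · rintro ⟨a, b⟩ hx hne
      obtain ⟨ha, hb, hn⟩ := mem_oddPairs.1 hx
      refine if_neg fun h => hne ?_
      simp only at h
      subst h
      have h1 : (t ^ 2 + 3) * b ^ 2 = (t ^ 2 + 3) * (2 * m + 1) ^ 2 := by
        rw [← hm, ← hn]
        ring
      have h2 : b = 2 * m + 1 :=
        Nat.pow_left_injective two_ne_zero (Nat.eq_of_mul_eq_mul_left (by positivity) h1)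
      rw [h2]
    · intro hx
      refine absurd (mem_oddPairs.2 ⟨?_, by omega, ?_⟩) hx
      · rw [Nat.mul_mod, ht]
        omega
      · rw [hm]
        ring
  · refine Finset.sum_eq_zero ?_
    rintro ⟨a, b⟩ hx
    obtain ⟨ha, hb, hn⟩ := mem_oddPairs.1 hx
    refine if_neg fun hab => h ⟨b / 2, ?_⟩
    simp only at hab
    rw [show 2 * (b / 2) + 1 = b by omega, ← hn, hab]
    ring

theorem coeff_Delta_mul_expand (n : ℕ) :
    coeff n (Delta * expand 3 three_ne_zero Delta) = ∑ _x ∈ oddPairs n, (1 : ZMod 2) := by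
  classical
  rw [coeff_mul]
  symm
  refine Finset.sum_of_injOn (fun x => (x.1 ^ 2, 3 * x.2 ^ 2)) ?_ ?_ ?_ ?_
  · rintro ⟨a, b⟩ - ⟨c, d⟩ - h
    simp only [Prod.mk.injEq] at h ⊢
    exact ⟨Nat.pow_left_injective two_ne_zero h.1,
      Nat.pow_left_injective two_ne_zero (Nat.eq_of_mul_eq_mul_left three_pos h.2)⟩
  · rintro ⟨a, b⟩ h
    have := mem_oddPairs.1 (Finset.mem_coe.1 h)
    simpa using this.2.2
  · rintro ⟨a, b⟩ h h'
    rw [Finset.HasAntidiagonal.mem_antidiagonal] at h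
    simp only at h ⊢
    rw [coeff_expand_Delta, Delta, coeff_mk]
    by_contra hne
    rw [mul_eq_zero, not_or] at hne
    obtain ⟨h1, h2⟩ := hne
    obtain ⟨c, rfl⟩ := of_not_not fun hc => h1 (if_neg hc)
    obtain ⟨d, rfl⟩ := of_not_not fun hd => h2 (if_neg hd)
    exact h' ⟨(2 * c + 1, 2 * d + 1),
      Finset.mem_coe.2 (mem_oddPairs.2 ⟨by omega, by omega, h⟩), rfl⟩
  · rintro ⟨a, b⟩ h
    obtain ⟨ha, hb, -⟩ := mem_oddPairs.1 h
    rw [coeff_expand_Delta, Delta, coeff_mk, if_pos, if_pos, mul_one]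
    · exact ⟨b / 2, by rw [show 2 * (b / 2) + 1 = b by omega]⟩
    · exact ⟨a / 2, by rw [show 2 * (a / 2) + 1 = a by omega]⟩

/-- The left side counts modulo 2 the odd pairs with a² + 3b² = n, so only fixed points of
`pairSwap` matter: a = b gives n = 4b² and a = 3b gives n = 12b², the exponents of Δ(q^4) = Δ^4 and
Δ(q^12) = Y^4. -/
theorem Delta_mul_expand_Delta :
    Delta * expand 3 three_ne_zero Delta = Delta ^ 4 + expand 3 three_ne_zero Delta ^ 4 := by
  classical
  rw [← map_pow, pow_four_eq_expand, ← expand_mul]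
  ext n
  rw [coeff_Delta_mul_expand, map_add, coeff_expand_Delta, coeff_expand_Delta]
  have h1 := sum_oddPairs_ite n 1 rfl
  have h3 := sum_oddPairs_ite n 3 rfl
  norm_num only at h1 h3 ⊢
  rw [← h1, ← h3]
  have key : ∑ x ∈ oddPairs n, ((1 : ZMod 2) + (if x.1 = 1 * x.2 then 1 else 0) +
      (if x.1 = 3 * x.2 then 1 else 0)) = 0 := by
    have hval : ∀ x ∈ oddPairs n, ((1 : ZMod 2) + (if x.1 = 1 * x.2 then 1 else 0) +
        (if x.1 = 3 * x.2 then 1 else 0)) = if pairSwap x = x then 0 else 1 := by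
      rintro ⟨a, b⟩ hx
      have hb := (mem_oddPairs.1 hx).2.1
      simp only [pairSwap_eq_self_iff hx]
      by_cases ha : a = 1 * b
      · rw [if_pos ha, if_neg (by omega), if_pos (Or.inl ha)]
        decide
      · by_cases ha' : a = 3 * b
        · rw [if_neg ha, if_pos ha', if_pos (Or.inr ha')]
          decide
        · rw [if_neg ha, if_neg ha', if_neg (by tauto)]
          decide
    rw [Finset.sum_congr rfl hval]
    refine Finset.sum_involution (fun x _ => pairSwap x) ?_ ?_ (fun x hx => pairSwap_mem hx)
      (fun x hx => pairSwap_pairSwap hx)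
    · intro x hx
      rw [pairSwap_pairSwap hx]
      by_cases h : pairSwap x = x
      · rw [if_pos h, if_pos h.symm, add_zero]
      · rw [if_neg h, if_neg fun h' => h h'.symm]
        decide
    · intro x hx h h'
      exact h (if_pos h')
  rw [Finset.sum_add_distrib, Finset.sum_add_distrib] at key
  have two : ∀ a b c : ZMod 2, a + b + c = 0 → a = b + c := by decide
  exact two _ _ _ (by simpa only [one_mul] using key)

/-- With Z = Δ(q^9), adding the modular equations of (Δ, Y) and (Y, Z) gives Y(Δ + Z) = (Δ + Z)^4;
then Δ + Z cancels. -/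
theorem Delta_add_expand_cube :
    (Delta + expand 3 three_ne_zero (expand 3 three_ne_zero Delta)) ^ 3 =
      expand 3 three_ne_zero Delta := by
  set Y := expand 3 three_ne_zero Delta with hY
  set Z := expand 3 three_ne_zero Y with hZ
  have h1 := Delta_mul_expand_Delta
  have h2 : Y * Z = Y ^ 4 + Z ^ 4 := by
    simpa only [map_mul, map_add, map_pow] using congrArg (expand 3 three_ne_zero) h1
  rw [← hY] at h1
  have two : (2 : PowerSeries (ZMod 2)) = 0 := CharTwo.two_eq_zero
  have hne : Delta + Z ≠ 0 := by
    intro h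
    have hc := congrArg (coeff 1) h
    rw [map_add, hZ, coeff_expand_of_not_dvd _ _ _ (by norm_num), ← pow_one Delta,
      coeff_Delta_pow_self] at hc
    simp at hc
  refine mul_left_cancel₀ hne ?_
  linear_combination -h1 - h2 + (2 * Delta ^ 3 * Z + 3 * Delta ^ 2 * Z ^ 2 + 2 * Delta * Z ^ 3 -
    Y ^ 4) * two

/-! ### The Hecke operator on the powers of `Δ` -/

/-- The modular equation is used twice: times Δ^k for `thin`, which turns factors Y into Δ, and
times Y^k for q ↦ q^3. -/
theorem hecke_Delta_pow_add_four (k : ℕ) :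
    hecke 3 (Delta ^ (k + 4)) =
      Delta * hecke 3 (Delta ^ (k + 1)) + Delta ^ 4 * hecke 3 (Delta ^ k) := by
  have h1 := Delta_mul_expand_Delta
  have two : (2 : PowerSeries (ZMod 2)) = 0 := CharTwo.two_eq_zero
  set Y := expand 3 three_ne_zero Delta with hY
  have h2 : Delta ^ (k + 4) = Delta ^ (k + 1) * Y + Delta ^ k * Y ^ 4 := by
    linear_combination (-Delta ^ k) * h1 - Delta ^ k * Y ^ 4 * two
  have h3 : thin (Delta ^ (k + 4)) =
      thin (Delta ^ (k + 1)) * Delta + thin (Delta ^ k) * Delta ^ 4 := by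
    rw [h2, map_add, hY, thin_mul_expand, ← map_pow, thin_mul_expand]
  rw [hecke_three_eq, hecke_three_eq, hecke_three_eq, h3,
    map_pow (expand 3 three_ne_zero), map_pow (expand 3 three_ne_zero),
    map_pow (expand 3 three_ne_zero), ← hY]
  linear_combination (-Y ^ k) * h1 - Y ^ k * Delta ^ 4 * two

theorem hecke_one : hecke 3 (1 : PowerSeries (ZMod 2)) = 0 := by
  rw [hecke_three_eq, map_one (expand 3 three_ne_zero)]
  have h : thin (1 : PowerSeries (ZMod 2)) = 1 := by
    simpa using thin_expand (1 : PowerSeries (ZMod 2))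
  rw [h, CharTwo.add_self_eq_zero]

theorem hecke_Delta : hecke 3 Delta = 0 := by
  rw [hecke_three_eq, thin_Delta, CharTwo.add_self_eq_zero]

theorem hecke_Delta_sq : hecke 3 (Delta ^ 2) = 0 := by
  rw [hecke_three_eq, thin_sq, thin_Delta, map_pow, CharTwo.add_self_eq_zero]

/-- Expanding `Delta_add_expand_cube` writes Δ^3 as Y + Δ^2 Z + Δ Z^2 + Z^3, whose image under
`thin` is Δ + 3Y^3; the substitution q ↦ q^3 adds another Y^3. -/
theorem hecke_Delta_cube : hecke 3 (Delta ^ 3) = Delta := by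
  set Y := expand 3 three_ne_zero Delta with hY
  have two : (2 : PowerSeries (ZMod 2)) = 0 := CharTwo.two_eq_zero
  have h1 : Delta ^ 3 = Y + Delta ^ 2 * expand 3 three_ne_zero Y +
      Delta * expand 3 three_ne_zero (Y ^ 2) + expand 3 three_ne_zero (Y ^ 3) := by
    rw [map_pow, map_pow]
    have h := Delta_add_expand_cube
    rw [← hY] at h
    set Z := expand 3 three_ne_zero Y
    linear_combination h - (2 * Delta ^ 2 * Z + 2 * Delta * Z ^ 2 + Z ^ 3) * two
  have hYt : thin Y = Delta := thin_expand Delta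
  rw [hecke_three_eq, map_pow (expand 3 three_ne_zero), ← hY, h1, map_add, map_add, map_add,
    thin_mul_expand, thin_mul_expand, thin_expand (Y ^ 3), hYt, thin_sq, thin_Delta, ← hY]
  linear_combination 2 * Y ^ 3 * two

/-- The polynomials with `T₃(Δ ^ k) = P_k(Δ)`. -/
noncomputable def heckePoly : ℕ → Polynomial (ZMod 2)
  | 0 => 0
  | 1 => 0
  | 2 => 0
  | 3 => Polynomial.X
  | k + 4 => Polynomial.X * heckePoly (k + 1) + Polynomial.X ^ 4 * heckePoly k

theorem hecke_Delta_pow (k : ℕ) :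
    hecke 3 (Delta ^ k) = Polynomial.aeval Delta (heckePoly k) := by
  induction k using heckePoly.induct with
  | case1 => simp [heckePoly, hecke_one]
  | case2 => simp [heckePoly, hecke_Delta]
  | case3 => simp [heckePoly, hecke_Delta_sq]
  | case4 => simp [heckePoly, hecke_Delta_cube]
  | case5 k ih1 ih2 =>
    rw [hecke_Delta_pow_add_four, ih1, ih2]
    simp [heckePoly]

theorem exists_of_coeff_heckePoly_ne_zero (k : ℕ) :
    ∀ j, (heckePoly k).coeff j ≠ 0 → ∃ a b, k = 3 + 3 * a + 4 * b ∧ j = 1 + a + 4 * b := by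
  induction k using heckePoly.induct with
  | case1 => simp [heckePoly]
  | case2 => simp [heckePoly]
  | case3 => simp [heckePoly]
  | case4 =>
    intro j hj
    rw [heckePoly, Polynomial.coeff_X] at hj
    refine ⟨0, 0, rfl, ?_⟩
    by_contra h
    exact hj (if_neg fun h' => h (by omega))
  | case5 k ih1 ih2 =>
    intro j hj
    -- Writing X as X^1 lets one coefficient lemma treat both products.
    rw [heckePoly, Polynomial.coeff_add, ← pow_one Polynomial.X, ← pow_mul,
      Polynomial.coeff_X_pow_mul', Polynomial.coeff_X_pow_mul'] at hj
    by_cases h1 : 1 ≤ j ∧ (heckePoly (k + 1)).coeff (j - 1) ≠ 0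
    · obtain ⟨a, b, hk, hj'⟩ := ih1 _ h1.2
      exact ⟨a + 1, b, by omega, by omega⟩
    · by_cases h2 : 4 ≤ j ∧ (heckePoly k).coeff (j - 4) ≠ 0
      · obtain ⟨a, b, hk, hj'⟩ := ih2 _ h2.2
        exact ⟨a, b + 1, by omega, by omega⟩
      · refine absurd ?_ hj
        push Not at h1 h2
        norm_num only
        split_ifs with h3 h4 h4
        · rw [h1 h3, h2 h4, add_zero]
        · rw [h1 h3, add_zero]
        · rw [h2 h4, add_zero]
        · rw [add_zero]

theorem coeff_heckePoly_add_four (k j : ℕ) :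
    (heckePoly (k + 4)).coeff (j + 1) =
      (heckePoly (k + 1)).coeff j + if 3 ≤ j then (heckePoly k).coeff (j - 3) else 0 := by
  rw [heckePoly, Polynomial.coeff_add, Polynomial.coeff_X_mul, Polynomial.coeff_X_pow_mul']
  simp

/-- The recurrence becomes Pascal's rule. The pair (a, b) is determined by the two indices, whose
difference is 2 + 2a; on the edges a = 0 or b = 0 one neighbour is absent and its coefficient
vanishes. -/
theorem coeff_heckePoly (a b : ℕ) :
    (heckePoly (3 + 3 * a + 4 * b)).coeff (1 + a + 4 * b) = ((a + b).choose a : ZMod 2) := by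
  induction h : a + b generalizing a b with
  | zero =>
    obtain ⟨rfl, rfl⟩ : a = 0 ∧ b = 0 := by omega
    simp [heckePoly]
  | succ N ih =>
    have hzero : ∀ k j, (¬ ∃ a b, k = 3 + 3 * a + 4 * b ∧ j = 1 + a + 4 * b) →
        (heckePoly k).coeff j = 0 := fun k j h => by
      by_contra h'
      exact h (exists_of_coeff_heckePoly_ne_zero k j h')
    rcases a with _ | a
    · obtain ⟨b, rfl⟩ : ∃ c, b = c + 1 := ⟨b - 1, by omega⟩
      have h1 := ih 0 b (by omega)
      rw [show 3 + 3 * 0 + 4 * (b + 1) = (3 + 3 * 0 + 4 * b) + 4 by ring,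
        show 1 + 0 + 4 * (b + 1) = (4 + 4 * b) + 1 by ring, coeff_heckePoly_add_four,
        if_pos (by omega), show 4 + 4 * b - 3 = 1 + 0 + 4 * b by omega, h1, hzero _ _ ?_]
      · simp
      · rintro ⟨c, d, h1, h2⟩
        omega
    · have h1 := ih a b (by omega)
      rw [show 1 + (a + 1) + 4 * b = (1 + a + 4 * b) + 1 by ring,
        show 3 + 3 * (a + 1) + 4 * b = (2 + 3 * a + 4 * b) + 4 by ring, coeff_heckePoly_add_four,
        show 2 + 3 * a + 4 * b + 1 = 3 + 3 * a + 4 * b by ring, h1]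
      rcases b with _ | b
      · obtain rfl : a = N := by omega
        have h2 : (heckePoly (2 + 3 * a + 4 * 0)).coeff (1 + a + 4 * 0 - 3) = 0 := by
          refine hzero _ _ ?_
          rintro ⟨c, d, h3, h4⟩
          omega
        rw [h2]
        simp
      · have h2 := ih (a + 1) b (by omega)
        rw [if_pos (by omega), show 2 + 3 * a + 4 * (b + 1) = 3 + 3 * (a + 1) + 4 * b by ring,
          show 1 + a + 4 * (b + 1) - 3 = 1 + (a + 1) + 4 * b by omega, h2,
          Nat.choose_succ_succ N a]
        push_cast
        ring

/-! ### Dominant exponents -/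

theorem aeval_Delta_eq_sum (Q : Polynomial (ZMod 2)) :
    Polynomial.aeval Delta Q = ∑ j ∈ Q.support, Delta ^ j := by
  rw [Polynomial.aeval_eq_sum_range,
    ← Finset.sum_subset Polynomial.supp_subset_range_natDegree_succ]
  · refine Finset.sum_congr rfl fun j hj => ?_
    have h1 : ∀ c : ZMod 2, c ≠ 0 → c = 1 := by decide
    rw [h1 _ (Polynomial.mem_support_iff.1 hj), one_smul]
  · intro j _ hj
    rw [Polynomial.notMem_support_iff.1 hj, zero_smul]

theorem hecke_sum_Delta_pow (s : Finset ℕ) :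
    hecke 3 (∑ k ∈ s, Delta ^ k) = ∑ j ∈ (∑ k ∈ s, heckePoly k).support, Delta ^ j := by
  rw [← aeval_Delta_eq_sum, map_sum, hecke_three_eq, map_sum, map_sum, ← Finset.sum_add_distrib]
  exact Finset.sum_congr rfl fun k _ => by rw [← hecke_three_eq, hecke_Delta_pow]

/-- The exponents of `T₃(Δ ^ k)` are dominated by the number whose code is that of `k` with the
first entry lowered by one. -/
theorem height_of_coeff_heckePoly_ne_zero {k j : ℕ} (hk : Odd k)
    (h : (heckePoly k).coeff j ≠ 0) :
    Odd j ∧ height j + 1 ≤ height k ∧ height j + n5 j + 1 ≤ height k + n5 k := by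
  obtain ⟨a, b, rfl, rfl⟩ := exists_of_coeff_heckePoly_ne_zero k j h
  rw [coeff_heckePoly, ZMod.natCast_ne_zero_iff_odd] at h
  rw [Nat.odd_iff] at hk
  -- As 3 + 3a + 4b is odd, a is even.
  obtain ⟨c, rfl⟩ : ∃ c, a = 2 * c := ⟨a / 2, by omega⟩
  refine ⟨Nat.odd_iff.2 (by omega), ?_⟩
  rw [show 3 + 3 * (2 * c) = 3 + 6 * c by ring]
  exact height_add_one_le h

theorem exists_coeff_heckePoly_eq_one {k : ℕ} (hk : Odd k) (h3 : 1 ≤ n3 k) :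
    ∃ j, (heckePoly k).coeff j = 1 ∧ n3 j + 1 = n3 k ∧ n5 j = n5 k := by
  obtain ⟨x, rfl⟩ := hk
  obtain ⟨a, b, rfl, hodd, h3, h5⟩ := exists_code_pred x h3
  refine ⟨1 + 2 * a + 4 * b, ?_, h3, h5⟩
  rw [show 2 * (1 + 3 * a + 2 * b) + 1 = 3 + 3 * (2 * a) + 4 * b by ring, coeff_heckePoly,
    ZMod.natCast_eq_one_iff_odd]
  exact hodd

theorem Dominated.of_le {j m : ℕ} (hj : Odd j) (hm : Odd m) (hne : j ≠ m)
    (h : height j ≤ height m) (h5 : height j + n5 j ≤ height m + n5 m) : Dominated j m := by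
  have hp : j % 2 = m % 2 := by rw [Nat.odd_iff.1 hj, Nat.odd_iff.1 hm]
  refine ⟨hp, ?_⟩
  rcases h.lt_or_eq with h | h
  · exact Or.inl h
  · refine Or.inr ⟨h, lt_of_le_of_ne (by omega) fun e => hne (code_injective_of_parity hp ?_ e)⟩
    simp only [height] at h
    omega

end ModTwoForms

open ModTwoForms

theorem proposition4p3 (f : PowerSeries (ZMod 2)) (hf : f ∈ ModTwoForms.oddForms) (hf0 : f ≠ 0)
    (m₁ : ℕ) (hm₁ : ModTwoForms.IsDominantExponent f m₁) :
    ModTwoForms.hecke 3 f ∈ ModTwoForms.oddForms ∧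
    ModTwoForms.formHeight f = (((ModTwoForms.height m₁ : ℕ) : ℤ) : WithBot ℤ) ∧
    ModTwoForms.formHeight (ModTwoForms.hecke 3 f) ≤
      ((((ModTwoForms.height m₁ : ℕ) : ℤ) - 1 : ℤ) : WithBot ℤ) ∧
    (1 ≤ ModTwoForms.n3 m₁ →
      ModTwoForms.formHeight (ModTwoForms.hecke 3 f) =
        ((((ModTwoForms.height m₁ : ℕ) : ℤ) - 1 : ℤ) : WithBot ℤ) ∧
      ∃ m : ℕ, ModTwoForms.IsDominantExponent (ModTwoForms.hecke 3 f) m ∧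
        ModTwoForms.code m = (ModTwoForms.n3 m₁ - 1, ModTwoForms.n5 m₁)) := by
  have hheight := hm₁.formHeight_eq
  obtain ⟨s, hodd, rfl, hm, hdom⟩ := hm₁
  have hT := hecke_sum_Delta_pow s
  set Q := ∑ k ∈ s, heckePoly k with hQ
  have hcoeff : ∀ j, Q.coeff j = ∑ k ∈ s, (heckePoly k).coeff j := fun j => by
    rw [hQ, Polynomial.finsetSum_coeff]
  -- A term Δ^k of smaller height may have larger `n5`; its exponents then satisfy the second
  -- alternative, a height drop of at least 2.
  have hsupp : ∀ j ∈ Q.support, Odd j ∧ height j + 1 ≤ height m₁ ∧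
      (height j + n5 j + 1 ≤ height m₁ + n5 m₁ ∨ height j + 2 ≤ height m₁) := by
    intro j hj
    rw [Polynomial.mem_support_iff, hcoeff] at hj
    obtain ⟨k, hk, hkj⟩ := Finset.exists_ne_zero_of_sum_ne_zero hj
    obtain ⟨h1, h2, h3⟩ := height_of_coeff_heckePoly_ne_zero (hodd k hk) hkj
    by_cases hkm : k = m₁
    · subst hkm
      exact ⟨h1, h2, Or.inl h3⟩
    · obtain ⟨-, h4⟩ := hdom k hk hkm
      exact ⟨h1, by omega, by omega⟩
  have hmem : hecke 3 (∑ k ∈ s, Delta ^ k) ∈ oddForms := by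
    rw [hT]
    exact Submodule.sum_mem _ fun j hj => Submodule.subset_span ⟨j, (hsupp j hj).1, rfl⟩
  refine ⟨hmem, hheight, ?_, fun h3 => ?_⟩
  · by_cases h0 : hecke 3 (∑ k ∈ s, Delta ^ k) = 0
    · rw [h0, formHeight_zero]
      exact bot_le
    · obtain ⟨m, hdm⟩ := exists_isDominantExponent hmem h0
      rw [hdm.formHeight_eq, WithBot.coe_le_coe]
      obtain ⟨t, -, ht, hmt, -⟩ := hdm
      obtain rfl : Q.support = t := exponents_unique (hT.symm.trans ht)
      have := (hsupp m hmt).2.1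
      omega
  · obtain ⟨j, hj, hj3, hj5⟩ := exists_coeff_heckePoly_eq_one (hodd m₁ hm) h3
    have hjh : height j + 1 = height m₁ := by
      simp only [height]
      omega
    have hQj : Q.coeff j = 1 := by
      rw [hcoeff, Finset.sum_eq_single m₁ _ fun h => absurd hm h, hj]
      -- No other k reaches j: equality of heights would be forced, and then n5 j ≤ n5 k < n5 m₁ =
      -- n5 j.
      intro k hk hkm
      by_contra hne
      obtain ⟨-, h4, h5⟩ := height_of_coeff_heckePoly_ne_zero (hodd k hk) hne
      obtain ⟨-, h6⟩ := hdom k hk hkm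
      omega
    have hjQ : j ∈ Q.support := by
      rw [Polynomial.mem_support_iff, hQj]
      exact one_ne_zero
    have hdm : IsDominantExponent (hecke 3 (∑ k ∈ s, Delta ^ k)) j := by
      refine ⟨Q.support, fun k hk => (hsupp k hk).1, hT, hjQ, fun k hk hkj => ?_⟩
      obtain ⟨h4, h5, h6⟩ := hsupp k hk
      rcases h6 with h6 | h6
      · exact Dominated.of_le h4 (hsupp j hjQ).1 hkj (by omega) (by omega)
      · exact ⟨by rw [Nat.odd_iff.1 h4, Nat.odd_iff.1 (hsupp j hjQ).1], Or.inl (by omega)⟩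
    refine ⟨?_, j, hdm, ?_⟩
    · rw [hdm.formHeight_eq, WithBot.coe_inj]
      omega
    · simp only [code, Prod.mk.injEq]
      omega
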